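/- **Setting.** An alphabet is a set $A$ with weights $|a|\in\mathbb N$, $|a|\ge 1$. $\mathcal F^A$ is the commutative monoid of finite non-planar rooted forests with vertices labelled in $A$ (unit: the empty forest $\varnothing$; product: juxtaposition), $[f]_a$ is the tree obtained by joining all roots of $f$ to a new root labelled $a$, $\bullet_a=[\varnothing]_a$, and the degree $|f|$ is the sum of the weights of the labels of $f$. A forest is *proper* if it is neither empty nor a tree. $\Delta_{CK}$ is the Connes–Kreimer coproduct, $\Delta_{CK}f=\sum f_{(1)}\otimes f_{(2)}$ over admissible cuts, with $f_{(1)}$ the part above and $f_{(2)}$ the part below the cut; $\widetilde\Delta_{CK}f=\Delta_{CK}f-f\otimes 1-1\otimes f$. Let $T\ge 0$, $p\ge 1$ and let $\omega$ be a control on $[0,T]$ (continuous, non-negative and superadditive on $\{0\le s\le t\le T\}$, zero on the diagonal). A *$p$-branched rough path* over $A$ controlled by $\omega$, written $X\in\mathscr C^p_\omega([0,T],\mathbb R^A)$, is a family of continuous functions $(s,t)\mapsto X^f_{st}$, $0\le s\le t\le T$, $f\in\mathcal F^A$, with $X^f=0$ for $|f|>\lfloor p\rfloor$, $X^{\varnothing}=1$,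 and (i) for each $f$ with $|f|\le\lfloor p\rfloor$ there is $K$ with $|X^f_{st}|\le K\,\omega(s,t)^{|f|/p}$ for all $s<t$; (ii) $X^f_{st}=\sum X^{f_{(1)}}_{su}X^{f_{(2)}}_{ut}$ for $s\le u\le t$, $|f|\le\lfloor p\rfloor$; (iii) $X^{fg}_{st}=X^f_{st}X^g_{st}$ for $|f|+|g|\le\lfloor p\rfloor$. We extend $f\mapsto X^f_{st}$ linearly to linear combinations $x$ of forests and write $\langle x,X_{st}\rangle$. *Bracket extensions.* $\widehat A=A\sqcup\{\text{proper forests in }\mathcal F^A\}$; the new letter given by $f$ is written $(f)$ and has weight $|f|$; we also write $(\bullet_a)=a$. Let $\mathcal J(f\otimes g)=0$ if $g=\varnothing$ or $g$ is a tree with more than one vertex, and $\mathcal J(f\otimes g)=[f]_{(g)}$ otherwise. A *bracket extension* of $X\in\mathscr C^p_\omega([0,T],\mathbb R^A)$ is $\widehat X\in\mathscr C^p_\omega([0,T],\mathbb R^{\widehat A})$ which agrees with $X$ on $\mathcal F^A$ and satisfies $\widehat X^{\bullet_{(f)}}=\langle f-\mathcal J\widetilde\Delta_{CK}f,\widehat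 X\rangle$ for all proper $f\in\mathcal F^A$. It is *consistent* if $$\langle f\curvearrowright_\nu g,\widehat X\rangle=\langle (\mathcal J\Delta_{CK}f)\curvearrowright_\nu g,\widehat X\rangle$$ for all $f,g\in\mathcal F^A$ with $f\neq\varnothing$ and all $\nu$, where $\nu$ is either a vertex of $g$, and $h\curvearrowright_\nu g$ is obtained by joining all roots of $h$ to $\nu$, or $\nu=-$, and $h\curvearrowright_- g=hg$ (extended linearly in $h$). *(Quasi-)geometricity.* Let $d\in\mathbb N$. The alphabet $[d]=\{1,\dots,d\}$ has all weights $1$; $\widetilde{[d]}$ is the set of non-empty finite multisets of elements of $[d]$, weighted by cardinality. On words in $\widetilde{[d]}$ the quasi-shuffle product $\mathbin{\tilde\ast}$ has the empty word as unit and satisfies $wa\,\mathbin{\tilde\ast}\,zb=(wa\,\mathbin{\tilde\ast}\,z)b+(w\,\mathbin{\tilde\ast}\,zb)a+(w\,\mathbin{\tilde\ast}\,z)(ab)$, with $(ab)=a\cup b$ (multiplicities added); on words in $[d]$ the shuffle product is given by the same recursion without the last term. Let $\widetilde\phi$ (respectively $\phi$) be the algebra morphism from linear combinations of forests to linear combinations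 of words with the quasi-shuffle (respectively shuffle) product such that $[f]_a\mapsto\phi(f)a$, and let $\iota$ be the linear map that sends a word to the ladder tree with these labels from top to bottom (the last letter is at the root). $X\in\mathscr C^p_\omega([0,T],\mathbb R^{\widetilde{[d]}})$ is *quasi-geometric* if $X^f=\langle\iota\widetilde\phi(f),X\rangle$ for all $f$, and $X\in\mathscr C^p_\omega([0,T],\mathbb R^{[d]})$ is *geometric* if $X^f=\langle\iota\phi(f),X\rangle$ for all $f$. **Theorem (Characterisation of (quasi-)geometric rough paths).** (A) For $X\in\mathscr C^p_\omega([0,T],\mathbb R^{\widetilde{[d]}})$, the following are equivalent: 1. $X$ is quasi-geometric; 2. the following family $\widehat X$ is a consistent bracket extension of $X$: $\widehat X^f=0$ if the forest $f$ (labelled in $\widehat{\widetilde{[d]}}$) has a label that is neither a letter of $\widetilde{[d]}$ nor of the form $(\bullet_{a_1}\cdots\bullet_{a_n})$; otherwise $\widehat X^f=X^{f'}$, where $f'$ is obtained from $f$ by replacing each label $(\bullet_{a_1}\cdots\bullet_{a_n})$ by the multiset $a_1\cup\dots\cup a_n\in\widetilde{[d]}$ (multiplicities added). (B) For $X\in\mathscr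 C^p_\omega([0,T],\mathbb R^{[d]})$, the following are equivalent: 1. $X$ is geometric; 2. the following family $\widehat X$ is a consistent bracket extension of $X$: $\widehat X^f=X^f$ for $f$ labelled in $[d]$, and $\widehat X^f=0$ if $f$ has at least one label in $\widehat{[d]}\setminus[d]$. -/

import Mathlib

open scoped TensorProduct

noncomputable section

/-! ## Labelled non-planar rooted forests -/

/-- Planar forests with vertices labelled in `α`: either empty, or a first tree (its root label `a`
and the forest `c` of the subtrees above the root) followed by the remaining trees `r`. -/
inductive PlanarForest (α : Type) : Type
  | nil : PlanarForest α
  | cons (a : α) (c r : PlanarForest α) : PlanarForest α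

namespace PlanarForest

variable {α : Type}

/-- Two planar forests represent the same non-planar forest when they differ by reordering the
trees of the forest and the children of its vertices. -/
inductive Equiv : PlanarForest α → PlanarForest α → Prop
  | refl (f : PlanarForest α) : Equiv f f
  | trans {f g h : PlanarForest α} : Equiv f g → Equiv g h → Equiv f h
  | cons (a : α) {c c' r r' : PlanarForest α} :
      Equiv c c' → Equiv r r' → Equiv (cons a c r) (cons a c' r')
  | swap (a b : α) (c c' r : PlanarForest α) :
      Equiv (cons a c (cons b c' r)) (cons b c' (cons a c r))

theorem Equiv.symm {f g : PlanarForest α} (h : Equiv f g) : Equiv g f := by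
  induction h with
  | refl f => exact .refl f
  | trans _ _ ih1 ih2 => exact .trans ih2 ih1
  | cons a _ _ ih1 ih2 => exact .cons a ih1 ih2
  | swap a b c c' r => exact .swap b a c' c r

instance setoid (α : Type) : Setoid (PlanarForest α) where
  r := Equiv
  iseqv := ⟨Equiv.refl, Equiv.symm, Equiv.trans⟩

/-- Juxtaposition of planar forests. -/
def append : PlanarForest α → PlanarForest α → PlanarForest α
  | nil, g => g
  | cons a c r, g => cons a c (append r g)

theorem append_nil (f : PlanarForest α) : append f nil = f := by
  induction f with
  | nil => rfl
  | cons a c r _ ih => simp [append, ih]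

theorem append_assoc (f g h : PlanarForest α) :
    append (append f g) h = append f (append g h) := by
  induction f with
  | nil => rfl
  | cons a c r _ ih => simp [append, ih]

theorem append_equiv_left {f f' : PlanarForest α} (h : Equiv f f') (g : PlanarForest α) :
    Equiv (append f g) (append f' g) := by
  induction h with
  | refl f => exact .refl _
  | trans _ _ ih1 ih2 => exact .trans ih1 ih2
  | cons a h1 _ _ ih2 => exact .cons a h1 ih2
  | swap a b c c' r => exact .swap a b c c' _

theorem append_equiv_right (f : PlanarForest α) {g g' : PlanarForest α} (h : Equiv g g') :
    Equiv (append f g) (append f g') := by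
  induction f with
  | nil => exact h
  | cons a c r _ ih => exact .cons a (.refl c) ih

theorem append_cons_equiv (f : PlanarForest α) (a : α) (c r : PlanarForest α) :
    Equiv (append f (cons a c r)) (cons a c (append f r)) := by
  induction f with
  | nil => exact .refl _
  | cons b c' r' _ ih => exact .trans (.cons b (.refl c') ih) (.swap b a c' c _)

theorem append_comm_equiv (f g : PlanarForest α) : Equiv (append f g) (append g f) := by
  induction f with
  | nil => rw [append_nil]; exact .refl _
  | cons a c r _ ih =>
    exact .trans (.cons a (.refl c) ih) (append_cons_equiv g a c r).symm

end PlanarForest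

/-- The set `𝓕^α` of (non-planar) rooted forests labelled in `α`. -/
def Forest (α : Type) : Type := Quotient (PlanarForest.setoid α)

namespace Forest

variable {α β : Type}

/-- Forests form a commutative monoid: the unit is the empty forest, the product is juxtaposition. -/
instance : CommMonoid (Forest α) where
  one := Quotient.mk _ PlanarForest.nil
  mul := Quotient.map₂ PlanarForest.append fun _ f' h _ g' h' =>
    (PlanarForest.append_equiv_left h _).trans (PlanarForest.append_equiv_right f' h')
  one_mul := by rintro ⟨f⟩; rfl
  mul_one := by
    rintro ⟨f⟩
    exact congrArg (Quotient.mk _) (PlanarForest.append_nil f)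
  mul_assoc := by
    rintro ⟨f⟩ ⟨g⟩ ⟨h⟩
    exact congrArg (Quotient.mk _) (PlanarForest.append_assoc f g h)
  mul_comm := by
    rintro ⟨f⟩ ⟨g⟩
    exact Quotient.sound (PlanarForest.append_comm_equiv f g)

/-- The tree `[f]_a`: all roots of `f` are joined to a new root labelled `a`. -/
def tree (a : α) (f : Forest α) : Forest α :=
  Quotient.map (fun c => PlanarForest.cons a c PlanarForest.nil)
    (fun _ _ h => PlanarForest.Equiv.cons a h (.refl _)) f

/-- The single vertex labelled `a`. -/
def vertex (a : α) : Forest α := tree a 1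

/-- Recursion on planar forests with values in a commutative monoid. -/
def foldPlanar {M : Type*} [CommMonoid M] (φ : α → Forest α → M → M) : PlanarForest α → M
  | .nil => 1
  | .cons a c r => φ a (Quotient.mk _ c) (foldPlanar φ c) * foldPlanar φ r

theorem foldPlanar_equiv {M : Type*} [CommMonoid M] (φ : α → Forest α → M → M)
    {f g : PlanarForest α} (h : PlanarForest.Equiv f g) : foldPlanar φ f = foldPlanar φ g := by
  induction h with
  | refl f => rfl
  | trans _ _ ih1 ih2 => exact ih1.trans ih2
  | cons a h1 _ ih1 ih2 =>
    simp only [foldPlanar]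
    rw [ih1, ih2, Quotient.sound (s := PlanarForest.setoid α) h1]
  | swap a b c c' r =>
    simp only [foldPlanar]
    exact mul_left_comm _ _ _

theorem foldPlanar_append {M : Type*} [CommMonoid M] (φ : α → Forest α → M → M)
    (f g : PlanarForest α) :
    foldPlanar φ (f.append g) = foldPlanar φ f * foldPlanar φ g := by
  induction f with
  | nil => simp [PlanarForest.append, foldPlanar]
  | cons a c r _ ih => simp only [PlanarForest.append, foldPlanar, ih, mul_assoc]

/-- Recursion on forests: `fold φ` is the multiplicative map with
`fold φ [f]_a = φ a f (fold φ f)`. -/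
def fold {M : Type*} [CommMonoid M] (φ : α → Forest α → M → M) : Forest α →* M where
  toFun := Quotient.lift (foldPlanar φ) fun _ _ h => foldPlanar_equiv φ h
  map_one' := rfl
  map_mul' := by
    rintro ⟨f⟩ ⟨g⟩
    exact foldPlanar_append φ f g

theorem fold_tree {M : Type*} [CommMonoid M] (φ : α → Forest α → M → M) (a : α) (f : Forest α) :
    fold φ (tree a f) = φ a f (fold φ f) := by
  induction f using Quotient.inductionOn with
  | h f => exact mul_one _

theorem induction_on {P : Forest α → Prop} (f : Forest α) (one : P 1)
    (tree_mul : ∀ a c r, P c → P r → P (tree a c * r)) : P f := by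
  induction f using Quotient.inductionOn with
  | h f =>
    induction f with
    | nil => exact one
    | cons a c r ih1 ih2 => exact tree_mul a _ _ ih1 ih2

/-- The multiset of the labels of all vertices of a forest. -/
def labels (f : Forest α) : Multiset α :=
  Multiplicative.toAdd
    (fold (fun a _ (m : Multiplicative (Multiset α)) => Multiplicative.ofAdd {a} * m) f)

theorem labels_one : labels (1 : Forest α) = 0 := rfl

theorem labels_mul (f g : Forest α) : labels (f * g) = labels f + labels g := by
  simp [labels]

theorem labels_tree (a : α) (f : Forest α) : labels (tree a f) = {a} + labels f := by
  simp [labels, fold_tree]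

/-- The degree `|f|`: the sum of the weights of the labels of the vertices. -/
def weight (w : α → ℕ) (f : Forest α) : ℕ := (f.labels.map w).sum

/-- Relabelling all vertices. -/
def map (j : α → β) : Forest α →* Forest β := fold fun a _ m => tree (j a) m

/-- Relabelling all vertices through a partially defined map of labels. The result is `0` (the
adjoined absorbing element) when at least one of the labels has no image. -/
def partialMap (j : α → Option β) : Forest α →* WithZero (Forest β) :=
  fold fun a _ m =>
    match j a with
    | none => 0
    | some b => WithZero.recZeroCoe 0 (fun g => ((tree b g : Forest β) : WithZero (Forest β))) m

/-- `f` is a tree, i.e. `f = [c]_a`. -/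
def IsTree (f : Forest α) : Prop := ∃ (a : α) (c : Forest α), f = tree a c

/-- `f` is proper: neither empty nor a tree. -/
def IsProper (f : Forest α) : Prop := f ≠ 1 ∧ ¬ f.IsTree

/-- `f` is a product of single vertices. -/
def IsVertexProduct (f : Forest α) : Prop :=
  ∃ m : Multiset α, f = (m.map vertex).prod

theorem labels_ne_zero {f : Forest α} (hf : f ≠ 1) : f.labels ≠ 0 := by
  induction f using Forest.induction_on with
  | one => exact absurd rfl hf
  | tree_mul a c r _ _ => simp [labels_mul, labels_tree]

end Forest

/-! ## The Connes-Kreimer Hopf algebra -/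

/-- The algebra `𝓗_CK^α`: formal linear combinations of forests, with the product of forests. -/
abbrev CK (α : Type) : Type := MonoidAlgebra ℝ (Forest α)

namespace CK

variable {α β : Type}

/-- A forest as a basis element. -/
def of (f : Forest α) : CK α := MonoidAlgebra.single f 1

/-- Linear extension of a function of forests. -/
def linExt {V : Type*} [AddCommGroup V] [Module ℝ V] (F : Forest α → V) : CK α →ₗ[ℝ] V :=
  Finsupp.linearCombination ℝ F ∘ₗ (MonoidAlgebra.coeffLinearEquiv ℝ).toLinearMap

theorem linExt_of {V : Type*} [AddCommGroup V] [Module ℝ V] (F : Forest α → V) (f : Forest α) :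
    linExt F (of f) = F f := by
  simp [linExt, of]

/-- The Connes-Kreimer coproduct (the sum of `f_C ⊗ f^C` over the admissible cuts `C` of `f`, with
the part above the cut on the left and the part below on the right) as an algebra morphism. An
admissible cut of a tree `[f]_a` is either total, or cuts each tree of `f` admissibly, where
the total cut of such a tree stands for cutting the edge that joins it to the root. -/
def coproduct : CK α →ₐ[ℝ] CK α ⊗[ℝ] CK α :=
  MonoidAlgebra.lift ℝ (CK α ⊗[ℝ] CK α) (Forest α) <|
    Forest.fold fun a f m =>
      of (Forest.tree a f) ⊗ₜ[ℝ] 1 +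
        TensorProduct.map LinearMap.id (linExt fun g => of (Forest.tree a g)) m

/-- The reduced coproduct. -/
def reducedCoproduct (x : CK α) : CK α ⊗[ℝ] CK α :=
  coproduct x - x ⊗ₜ[ℝ] 1 - 1 ⊗ₜ[ℝ] x

end CK

/-! ## Branched rough paths

An element `x` of the Grossman-Larson algebra truncated at degree `N` is represented by its
coordinates `f ↦ ⟨f, x⟩`, a function of forests that vanishes on forests of degree more than `N`. -/

/-- `⟨x, X⟩` for `x` a linear combination of forests. -/
def pairing {α : Type} (x : CK α) (X : Forest α → ℝ) : ℝ := CK.linExt X x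

/-- The simplex of the pairs `(s, t)` with `0 ≤ s ≤ t ≤ T`. -/
def simplex (T : ℝ) : Set (ℝ × ℝ) := {q | 0 ≤ q.1 ∧ q.1 ≤ q.2 ∧ q.2 ≤ T}

/-- `ω` is a control on `[0, T]`. -/
structure IsControl (T : ℝ) (ω : ℝ → ℝ → ℝ) : Prop where
  continuousOn : ContinuousOn (fun q : ℝ × ℝ => ω q.1 q.2) (simplex T)
  nonneg : ∀ s t, 0 ≤ s → s ≤ t → t ≤ T → 0 ≤ ω s t
  diag : ∀ t, 0 ≤ t → t ≤ T → ω t t = 0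
  superadditive : ∀ s u t, 0 ≤ s → s ≤ u → u ≤ t → t ≤ T → ω s u + ω u t ≤ ω s t

/-- `X` (with `X s t f` the coordinate `X^f_{st}`) is a `p`-branched rough path on `[0, T]`
controlled by `ω`, over the alphabet `α` with weights `w`. -/
structure IsBranchedRoughPath {α : Type} (w : α → ℕ) (T p : ℝ) (ω : ℝ → ℝ → ℝ)
    (X : ℝ → ℝ → Forest α → ℝ) : Prop where
  truncated : ∀ s t, 0 ≤ s → s ≤ t → t ≤ T → ∀ f : Forest α, ⌊p⌋₊ < f.weight w → X s t f = 0
  continuousOn : ∀ f : Forest α, ContinuousOn (fun q : ℝ × ℝ => X q.1 q.2 f) (simplex T)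
  unit : ∀ s t, 0 ≤ s → s ≤ t → t ≤ T → X s t 1 = 1
  regularity : ∀ f : Forest α, f.weight w ≤ ⌊p⌋₊ → ∃ K : ℝ, ∀ s t, 0 ≤ s → s < t → t ≤ T →
    |X s t f| ≤ K * ω s t ^ ((f.weight w : ℝ) / p)
  multiplicativity : ∀ s u t, 0 ≤ s → s ≤ u → u ≤ t → t ≤ T →
    ∀ f : Forest α, f.weight w ≤ ⌊p⌋₊ →
      X s t f = LinearMap.mul' ℝ ℝ
        (TensorProduct.map (CK.linExt (X s u)) (CK.linExt (X u t)) (CK.coproduct (CK.of f)))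
  products : ∀ s t, 0 ≤ s → s ≤ t → t ≤ T →
    ∀ f g : Forest α, f.weight w + g.weight w ≤ ⌊p⌋₊ → X s t (f * g) = X s t f * X s t g

/-! ## Bracket extensions -/

/-- The alphabet `α` enlarged by all proper forests labelled in `α`. -/
def Hat (α : Type) : Type := α ⊕ {f : Forest α // f.IsProper}

namespace Hat

variable {α : Type}

/-- An old letter as a letter of the enlarged alphabet. -/
def letter (a : α) : Hat α := Sum.inl a

/-- The new letter `(f)`, for `f` a proper forest. -/
def bracket (f : Forest α) (hf : f.IsProper) : Hat α := Sum.inr ⟨f, hf⟩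

/-- The weight of a letter: that of the old letter, or the degree of the forest. -/
def weight (w : α → ℕ) : Hat α → ℕ
  | .inl a => w a
  | .inr f => f.1.weight w

open Classical in
/-- The letter `(f)` defined by a forest `f`: it is the new letter `(f)` if `f` is proper, the old
letter `a` if `f` is the single vertex `a`; it does not exist for other forests. -/
def ofForest (f : Forest α) : Option (Hat α) :=
  if hf : f.IsProper then some (bracket f hf)
  else if h : ∃ a : α, f = Forest.vertex a then some (letter h.choose)
  else none

end Hat

/-- The root labelling map `J (f ⊗ g) = [f]_(g)`, which is `0` if `g` is empty or a tree with more
than one vertex. -/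
def rootLabel {α : Type} : CK α ⊗[ℝ] CK α →ₗ[ℝ] CK (Hat α) :=
  TensorProduct.lift <| CK.linExt fun f => CK.linExt fun g =>
    match Hat.ofForest g with
    | none => 0
    | some b => CK.of (Forest.tree b (f.map Hat.letter))

/-- The bracket polynomial of `f`. -/
def bracketPolynomial {α : Type} (f : Forest α) : CK (Hat α) :=
  CK.of (f.map Hat.letter) - rootLabel (CK.reducedCoproduct (CK.of f))

/-- A forest `g` together with a place `ν` where another forest can be grafted:
* `beside g`: the forest is `g` and `ν = -`, i.e. grafting is multiplication with `g`;
* `under a P g`: the forest is `[h]_a g` with `h` the forest of `P`. If `P` has `ν = -`, then `ν`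
  is the root of `[h]_a`; otherwise it is the vertex of `h` given by `P`. -/
inductive MarkedForest (α : Type) : Type
  | beside (g : Forest α) : MarkedForest α
  | under (a : α) (P : MarkedForest α) (g : Forest α) : MarkedForest α

namespace MarkedForest

variable {α β : Type}

/-- The forest obtained by grafting each root of `f` onto the marked place. -/
def graft : MarkedForest α → Forest α → Forest α
  | beside g, f => f * g
  | under a P g, f => Forest.tree a (graft P f) * g

/-- Relabelling. -/
def map (j : α → β) : MarkedForest α → MarkedForest β
  | beside g => beside (g.map j)
  | under a P g => under (j a) (map j P) (g.map j)

end MarkedForest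

/-- `Y` is a (full) bracket extension of `X`. -/
structure IsBracketExtension {α : Type} (w : α → ℕ) (T p : ℝ) (ω : ℝ → ℝ → ℝ)
    (X : ℝ → ℝ → Forest α → ℝ) (Y : ℝ → ℝ → Forest (Hat α) → ℝ) : Prop where
  roughPath : IsBranchedRoughPath (Hat.weight w) T p ω Y
  extends_base : ∀ s t, 0 ≤ s → s ≤ t → t ≤ T → ∀ f : Forest α, Y s t (f.map Hat.letter) = X s t f
  bracket : ∀ s t, 0 ≤ s → s ≤ t → t ≤ T → ∀ (f : Forest α) (hf : f.IsProper),
    Y s t (Forest.vertex (Hat.bracket f hf)) = pairing (bracketPolynomial f) (Y s t)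

/-- `Y` is a consistent (full) bracket extension of `X`: the bracket relations hold also after
grafting onto an arbitrary vertex of an arbitrary forest labelled in `α`. -/
structure IsConsistentBracketExtension {α : Type} (w : α → ℕ) (T p : ℝ) (ω : ℝ → ℝ → ℝ)
    (X : ℝ → ℝ → Forest α → ℝ) (Y : ℝ → ℝ → Forest (Hat α) → ℝ) : Prop
    extends IsBracketExtension w T p ω X Y where
  consistency : ∀ s t, 0 ≤ s → s ≤ t → t ≤ T → ∀ f : Forest α, f ≠ 1 → ∀ P : MarkedForest α,
    Y s t ((P.map Hat.letter).graft (f.map Hat.letter)) =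
      pairing
        (CK.linExt (fun h => CK.of ((P.map Hat.letter).graft h))
          (rootLabel (CK.coproduct (CK.of f))))
        (Y s t)

/-! ## Words and the quasi-shuffle algebra -/

/-- Words in the alphabet `α`; `snoc w a` is the word `w a`. -/
inductive Word (α : Type) : Type
  | empty : Word α
  | snoc (w : Word α) (a : α) : Word α

namespace Word

/-- The number of letters. -/
def length {α : Type} : Word α → ℕ
  | empty => 0
  | snoc w _ => length w + 1

end Word

/-- A commutative, associative bracket `(a b)` of letters, with values in the letters or zero
(`none`). -/
structure LetterBracket (α : Type) where
  br : α → α → Option α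
  comm : ∀ a b, br a b = br b a
  assoc : ∀ a b c, (br a b).bind (fun x => br x c) = (br b c).bind (fun y => br a y)

/-- The module of linear combinations of words, to be equipped with the quasi-shuffle product with
respect to the bracket `B`. -/
def QuasiShuffle {α : Type} (_B : LetterBracket α) : Type := Word α →₀ ℝ

namespace QuasiShuffle

variable {α : Type} (B : LetterBracket α)

instance : AddCommGroup (QuasiShuffle B) := inferInstanceAs (AddCommGroup (Word α →₀ ℝ))
instance : Module ℝ (QuasiShuffle B) := inferInstanceAs (Module ℝ (Word α →₀ ℝ))

/-- A word as a basis element. -/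
def word (w : Word α) : QuasiShuffle B := Finsupp.single w 1

/-- Linear extension of a function of words. -/
def linExt {V : Type*} [AddCommGroup V] [Module ℝ V] (F : Word α → V) :
    QuasiShuffle B →ₗ[ℝ] V :=
  Finsupp.linearCombination ℝ F

theorem linExt_word {V : Type*} [AddCommGroup V] [Module ℝ V] (F : Word α → V) (w : Word α) :
    linExt B F (word B w) = F w := by
  exact (Finsupp.linearCombination_single ℝ 1 w).trans (one_smul ℝ (F w))

theorem hom_ext {V : Type*} [AddCommGroup V] [Module ℝ V] {F G : QuasiShuffle B →ₗ[ℝ] V}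
    (h : ∀ w, F (word B w) = G (word B w)) : F = G :=
  Finsupp.lhom_ext' fun w => LinearMap.ext_ring (h w)

/-- Appending a letter at the end of each word. -/
def appendLetter (a : α) : QuasiShuffle B →ₗ[ℝ] QuasiShuffle B :=
  linExt B fun w => word B (w.snoc a)

/-- Appending a letter or zero. -/
def appendOption : Option α → (QuasiShuffle B →ₗ[ℝ] QuasiShuffle B)
  | none => 0
  | some a => appendLetter B a

/-- The quasi-shuffle product of words, by the recursion
`(w a) * (z b) = ((w a) * z) b + (w * (z b)) a + (w * z) (a b)`. -/
def mulWord : Word α → Word α → QuasiShuffle B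
  | .empty, z => word B z
  | .snoc w a, .empty => word B (.snoc w a)
  | .snoc w a, .snoc z b =>
    appendLetter B b (mulWord (.snoc w a) z) + appendLetter B a (mulWord w (.snoc z b)) +
      appendOption B (B.br a b) (mulWord w z)
termination_by w z => w.length + z.length
decreasing_by all_goals simp only [Word.length]; omega

/-- The quasi-shuffle product. -/
def mulLin : QuasiShuffle B →ₗ[ℝ] QuasiShuffle B →ₗ[ℝ] QuasiShuffle B :=
  linExt B fun w => linExt B fun z => mulWord B w z

theorem mulLin_word (w z : Word α) : mulLin B (word B w) (word B z) = mulWord B w z := by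
  simp [mulLin, linExt_word]

theorem mulWord_empty_left (z : Word α) : mulWord B .empty z = word B z := by
  rw [mulWord]

theorem mulWord_empty_right (w : Word α) : mulWord B w .empty = word B w := by
  cases w <;> rw [mulWord]

theorem mulWord_comm (w z : Word α) : mulWord B w z = mulWord B z w := by
  induction w generalizing z with
  | empty => rw [mulWord_empty_left, mulWord_empty_right]
  | snoc w a ihw =>
    induction z with
    | empty => rw [mulWord_empty_left, mulWord_empty_right]
    | snoc z b ihz =>
      rw [mulWord, mulWord, ihz, ihw, ihw, B.comm a b]
      abel

theorem mulLin_comm (x y : QuasiShuffle B) : mulLin B x y = mulLin B y x := by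
  have h : mulLin B = (mulLin B).flip :=
    hom_ext B fun w => hom_ext B fun z => by
      rw [LinearMap.flip_apply, mulLin_word, mulLin_word, mulWord_comm]
  exact congrArg (fun F => F x y) h

theorem appendLetter_word (a : α) (w : Word α) :
    appendLetter B a (word B w) = word B (w.snoc a) := by
  simp [appendLetter, linExt_word]

theorem mulLin_append (a b : α) (x y : QuasiShuffle B) :
    mulLin B (appendLetter B a x) (appendLetter B b y) =
      appendLetter B b (mulLin B (appendLetter B a x) y) +
      appendLetter B a (mulLin B x (appendLetter B b y)) +
      appendOption B (B.br a b) (mulLin B x y) := by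
  have h : ((mulLin B).compl₁₂ (appendLetter B a) (appendLetter B b)) =
      ((mulLin B) ∘ₗ appendLetter B a).compr₂ (appendLetter B b) +
      ((mulLin B).compl₂ (appendLetter B b)).compr₂ (appendLetter B a) +
      (mulLin B).compr₂ (appendOption B (B.br a b)) :=
    hom_ext B fun w => hom_ext B fun z => by
      simp only [LinearMap.compl₁₂_apply, LinearMap.add_apply, LinearMap.compr₂_apply,
        LinearMap.comp_apply, LinearMap.compl₂_apply, appendLetter_word, mulLin_word]
      rw [mulWord]
  exact congrArg (fun F => F x y) h

theorem mulLin_appendOption (o : Option α) (c : α) (x y : QuasiShuffle B) :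
    mulLin B (appendOption B o x) (appendLetter B c y) =
      appendLetter B c (mulLin B (appendOption B o x) y) +
      appendOption B o (mulLin B x (appendLetter B c y)) +
      appendOption B (o.bind fun a => B.br a c) (mulLin B x y) := by
  cases o with
  | none => simp [appendOption]
  | some a => exact mulLin_append B a c x y

theorem mulLin_appendOption_right (a : α) (o : Option α) (x y : QuasiShuffle B) :
    mulLin B (appendLetter B a x) (appendOption B o y) =
      appendOption B o (mulLin B (appendLetter B a x) y) +
      appendLetter B a (mulLin B x (appendOption B o y)) +
      appendOption B (o.bind fun c => B.br a c) (mulLin B x y) := by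
  cases o with
  | none => simp [appendOption]
  | some b => exact mulLin_append B a b x y

theorem empty_mulLin (x : QuasiShuffle B) : mulLin B (word B .empty) x = x := by
  have h : mulLin B (word B .empty) = LinearMap.id :=
    hom_ext B fun z => by rw [mulLin_word, mulWord_empty_left]; rfl
  rw [h]; rfl

theorem mulLin_empty (x : QuasiShuffle B) : mulLin B x (word B .empty) = x := by
  rw [mulLin_comm, empty_mulLin]

theorem word_assoc (n : ℕ) : ∀ u v w : Word α, u.length + v.length + w.length ≤ n →
    mulLin B (mulLin B (word B u) (word B v)) (word B w) =
      mulLin B (word B u) (mulLin B (word B v) (word B w)) := by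
  induction n with
  | zero =>
    intro u v w h
    cases u with
    | empty => rw [empty_mulLin, empty_mulLin]
    | snoc u a => simp only [Word.length] at h; omega
  | succ n ih =>
    intro u v w h
    cases u with
    | empty => rw [empty_mulLin, empty_mulLin]
    | snoc u a =>
      cases v with
      | empty => rw [empty_mulLin, mulLin_empty]
      | snoc v b =>
        cases w with
        | empty => rw [mulLin_empty, mulLin_empty]
        | snoc w c =>
          simp only [Word.length] at h
          have h1 := ih u (v.snoc b) (w.snoc c) (by simp only [Word.length]; omega)
          have h2 := ih (u.snoc a) v (w.snoc c) (by simp only [Word.length]; omega)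
          have h3 := ih (u.snoc a) (v.snoc b) w (by simp only [Word.length]; omega)
          have h4 := ih u v (w.snoc c) (by simp only [Word.length]; omega)
          have h5 := ih u (v.snoc b) w (by simp only [Word.length]; omega)
          have h6 := ih (u.snoc a) v w (by simp only [Word.length]; omega)
          have h7 := ih u v w (by omega)
          simp only [← appendLetter_word] at h1 h2 h3 h4 h5 h6 ⊢
          generalize word B u = x at *
          generalize word B v = y at *
          generalize word B w = z at *
          rw [mulLin_append B a b] at h3 ⊢
          rw [mulLin_append B b c] at h1 ⊢
          simp only [map_add, LinearMap.add_apply] at h1 h3 ⊢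
          rw [mulLin_append B b c (mulLin B (appendLetter B a x) y) z,
            mulLin_append B a c (mulLin B x (appendLetter B b y)) z,
            mulLin_appendOption B (B.br a b) c (mulLin B x y) z,
            mulLin_append B a c x (mulLin B (appendLetter B b y) z),
            mulLin_append B a b x (mulLin B y (appendLetter B c z)),
            mulLin_appendOption_right B a (B.br b c) x (mulLin B y z),
            h2, h4, h5, h6, h7, h1, ← h3, ← B.assoc]
          simp only [map_add]
          abel

theorem mulLin_assoc (x y z : QuasiShuffle B) :
    mulLin B (mulLin B x y) z = mulLin B x (mulLin B y z) := by
  have h : (mulLin B).compr₂ (mulLin B) =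
      (LinearMap.llcomp ℝ _ _ _ ∘ₗ mulLin B).compl₂ (mulLin B) := by
    refine hom_ext B fun u => hom_ext B fun v => hom_ext B fun w => ?_
    exact word_assoc B _ u v w le_rfl
  exact congrArg (fun F => F x y z) h

/-- The (quasi-)shuffle algebra. -/
instance : CommRing (QuasiShuffle B) :=
  { (inferInstance : AddCommGroup (QuasiShuffle B)) with
    mul := fun x y => mulLin B x y
    one := word B .empty
    mul_assoc := mulLin_assoc B
    mul_comm := mulLin_comm B
    one_mul := empty_mulLin B
    mul_one := mulLin_empty B
    left_distrib := fun x y z => map_add (mulLin B x) y z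
    right_distrib := fun x y z => by
      change mulLin B (x + y) z = mulLin B x z + mulLin B y z
      rw [map_add, LinearMap.add_apply]
    zero_mul := fun x => by
      change mulLin B 0 x = 0
      rw [map_zero, LinearMap.zero_apply]
    mul_zero := fun x => map_zero (mulLin B x) }

instance : Algebra ℝ (QuasiShuffle B) :=
  Algebra.ofModule
    (fun r x y => by
      change mulLin B (r • x) y = r • mulLin B x y
      rw [map_smul, LinearMap.smul_apply])
    (fun r x y => map_smul (mulLin B x) r y)

theorem word_mul_word (w z : Word α) : word B w * word B z = mulWord B w z := mulLin_word B w z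

/-- The algebra morphism from forests to words with `φ [f]_a = φ(f) a`. -/
def phi : CK α →ₐ[ℝ] QuasiShuffle B :=
  MonoidAlgebra.lift ℝ (QuasiShuffle B) (Forest α) <|
    Forest.fold fun a _ m => appendLetter B a m

/-- The ladder tree of a word, with the last letter at the root (the empty forest for the
empty word). -/
def ladder : Word α → Forest α
  | .empty => 1
  | .snoc w a => Forest.tree a (ladder w)

/-- The linear inclusion of words into forests as ladder trees. -/
def iota : QuasiShuffle B →ₗ[ℝ] CK α := linExt B fun w => CK.of (ladder w)

end QuasiShuffle

/-- The zero bracket of letters; the corresponding quasi-shuffle algebra is the shuffle algebra. -/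
def zeroBracket (α : Type) : LetterBracket α where
  br _ _ := none
  comm _ _ := rfl
  assoc _ _ _ := rfl

/-- The alphabet of non-empty finite multisets of letters of `κ`. -/
def Tilde (κ : Type) : Type := {m : Multiset κ // m ≠ 0}

namespace Tilde

variable {κ : Type}

/-- The weight of a multiset: its cardinality, counting repetitions. -/
def weight (m : Tilde κ) : ℕ := Multiset.card m.1

/-- The free bracket `(a b)`, the union (with multiplicities added) of the multisets `a`, `b`. -/
def unionBracket (κ : Type) : LetterBracket (Tilde κ) where
  br a b := some ⟨a.1 + b.1, fun h => a.2 (add_eq_zero.mp h).1⟩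
  comm a b := congrArg some (Subtype.ext (add_comm a.1 b.1))
  assoc a b c := congrArg some (Subtype.ext (add_assoc a.1 b.1 c.1))

/-- The union (with multiplicities added) of all labels of a non-empty forest. -/
def joinLabels (f : Forest (Tilde κ)) (hf : f ≠ 1) : Tilde κ :=
  ⟨(f.labels.map Subtype.val).sum, fun h => by
    obtain ⟨a, ha⟩ := Multiset.exists_mem_of_ne_zero (Forest.labels_ne_zero hf)
    exact a.2 (Multiset.sum_eq_zero_iff.mp h _ (Multiset.mem_map_of_mem _ ha))⟩

open Classical in
/-- Label joining: an old letter is unchanged, a new letter `(a_1 ⋯ a_n)`, given by a product of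
single vertices, is sent to the union of the multisets `a_1, …, a_n`. The other letters have no
image. -/
def join : Hat (Tilde κ) → Option (Tilde κ)
  | .inl a => some a
  | .inr f => if f.1.IsVertexProduct then some (joinLabels f.1 f.2.1) else none

end Tilde

/-! ## Geometric and quasi-geometric rough paths -/

/-- `X = X^{ι ∘ φ}` on `[0, T]`, with `φ` taking values in the quasi-shuffle algebra of `B`. -/
def IsDeterminedByLadders {α : Type} (B : LetterBracket α) (T : ℝ)
    (X : ℝ → ℝ → Forest α → ℝ) : Prop :=
  ∀ s t, 0 ≤ s → s ≤ t → t ≤ T → ∀ f : Forest α,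
    X s t f = pairing (QuasiShuffle.iota B (QuasiShuffle.phi B (CK.of f))) (X s t)

/-- A branched rough path is geometric if `X = X^{ι ∘ φ}`, with the shuffle product. -/
def IsGeometric {α : Type} (T : ℝ) (X : ℝ → ℝ → Forest α → ℝ) : Prop :=
  IsDeterminedByLadders (zeroBracket α) T X

/-- A branched rough path over the alphabet of multisets is quasi-geometric if `X = X^{ι ∘ φ}`,
with the quasi-shuffle product. -/
def IsQuasiGeometric {κ : Type} (T : ℝ) (X : ℝ → ℝ → Forest (Tilde κ) → ℝ) : Prop :=
  IsDeterminedByLadders (Tilde.unionBracket κ) T X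

/-- Extension to a larger alphabet through a partial map of labels: the value at `f` is `0` if some
label of `f` has no image, and the value of `X` at the relabelled forest otherwise. -/
def extendThrough {α β : Type} (j : β → Option α) (X : ℝ → ℝ → Forest α → ℝ)
    (s t : ℝ) (f : Forest β) : ℝ :=
  WithZero.recZeroCoe (motive := fun _ => ℝ) 0 (X s t) (f.partialMap j)

/-- The extension that is `0` on forests with a new label. -/
def trivialExtension {α : Type} (X : ℝ → ℝ → Forest α → ℝ) : ℝ → ℝ → Forest (Hat α) → ℝ :=
  extendThrough (fun b : Hat α => Sum.getLeft? b) X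

/-- The extension that is `0` on forests with a new label which is not a product of single vertices,
and joins labels on the other forests. -/
def joinExtension {κ : Type} (X : ℝ → ℝ → Forest (Tilde κ) → ℝ) :
    ℝ → ℝ → Forest (Hat (Tilde κ)) → ℝ :=
  extendThrough Tilde.join X

end

/-! Both parts are instances of one equivalence, `isDeterminedByLadders_iff`, for a bracket `B` of
letters and a partial relabelling `j` of the enlarged alphabet: join labels for the union bracket,
or forget all new letters for the zero bracket. Compatibility of `j` with `B` is expressed by
`IsForestBracket`: the image `k(g)` of the letter `(g)` is the iterated bracket of the labels of `g`
if `g` is a nonempty product of single vertices, and does not exist otherwise.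

The candidate extension is `X` composed with the algebra morphism `CK.relabel j`, which respects
products and coproducts, so it is again a rough path. Under this morphism the root labelling map
becomes `f ⊗ g ↦ [f]_{k(g)}`, and everything rests on the identity `φ(Σ [f₁]_{k(f₂)}) = φ(f) -
ε(f)`, summed over the coproduct of `f` (`phi_plantBracket_coproduct`). Its meaning is that the last
letter of a word in `φ(f)` comes from one root, or from several roots merged by the bracket.

If `X` factors through `φ`, consistency follows, because `φ` of a grafting depends only on `φ` of
what is grafted. Conversely, each use of consistency replaces the grafted forest by terms with a
single root and a strictly smaller forest above it. Absorbing that root into the marked place and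
inducting on the number of vertices unrolls `f` into ladders, and the same identity shows that the
result is `ι(φ(f))`. -/

noncomputable section

/-! ### Additive invariants that detect the shape of a forest -/

namespace Forest

variable {α β : Type}

/-- The number of trees of a forest. -/
def rootCount (f : Forest α) : ℕ :=
  Multiplicative.toAdd (fold (fun _ _ _ => (Multiplicative.ofAdd 1 : Multiplicative ℕ)) f)

theorem rootCount_one : rootCount (1 : Forest α) = 0 := rfl

theorem rootCount_mul (f g : Forest α) : rootCount (f * g) = rootCount f + rootCount g := by
  simp [rootCount]

theorem rootCount_tree (a : α) (f : Forest α) : rootCount (tree a f) = 1 := by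
  simp [rootCount, fold_tree]

theorem rootCount_eq_zero {f : Forest α} : rootCount f = 0 ↔ f = 1 := by
  refine ⟨fun h => ?_, fun h => h ▸ rootCount_one⟩
  induction f using Forest.induction_on with
  | one => rfl
  | tree_mul a c r _ _ => rw [rootCount_mul, rootCount_tree] at h; omega

theorem rootCount_eq_one {f : Forest α} : rootCount f = 1 ↔ f.IsTree := by
  constructor
  · intro h
    induction f using Forest.induction_on with
    | one => rw [rootCount_one] at h; omega
    | tree_mul a c r _ _ =>
      rw [rootCount_mul, rootCount_tree] at h
      have hr : r = 1 := rootCount_eq_zero.mp (by omega)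
      exact ⟨a, c, by rw [hr, mul_one]⟩
  · rintro ⟨a, c, rfl⟩
    exact rootCount_tree a c

/-- Forests form a quotient, so a product cannot be inspected through its representatives. The
number of roots is additive, which turns properness into arithmetic. -/
theorem isProper_iff {f : Forest α} : f.IsProper ↔ 2 ≤ rootCount f := by
  rw [IsProper, ← rootCount_eq_one, Ne, ← rootCount_eq_zero]
  omega

theorem tree_mul_ne_one (a : α) (c r : Forest α) : tree a c * r ≠ 1 := by
  rw [Ne, ← rootCount_eq_zero, rootCount_mul, rootCount_tree]
  omega

theorem isProper_tree_mul_iff {a : α} {c r : Forest α} : (tree a c * r).IsProper ↔ r ≠ 1 := by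
  rw [isProper_iff, rootCount_mul, rootCount_tree, Ne, ← rootCount_eq_zero]
  omega

theorem labels_vertex (a : α) : labels (vertex a) = {a} := by
  rw [vertex, labels_tree, labels_one, add_zero]

theorem vertex_injective : Function.Injective (vertex : α → Forest α) := fun a b h => by
  have := congrArg labels h
  rwa [labels_vertex, labels_vertex, Multiset.singleton_inj] at this

theorem tree_eq_vertex {a b : α} {c : Forest α} (h : tree a c = vertex b) : c = 1 := by
  by_contra hc
  have := congrArg (fun f => Multiset.card (labels f)) h
  simp only [labels_tree, labels_vertex, Multiset.card_add, Multiset.card_singleton] at this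
  exact labels_ne_zero hc (Multiset.card_eq_zero.mp (by omega))

/-- The number of edges of a forest. -/
def edgeCount (f : Forest α) : ℕ :=
  Multiplicative.toAdd
    (fold (fun _ c _ => (Multiplicative.ofAdd (Multiset.card c.labels) : Multiplicative ℕ)) f)

theorem edgeCount_one : edgeCount (1 : Forest α) = 0 := rfl

theorem edgeCount_mul (f g : Forest α) : edgeCount (f * g) = edgeCount f + edgeCount g := by
  simp [edgeCount]

theorem edgeCount_tree (a : α) (f : Forest α) :
    edgeCount (tree a f) = Multiset.card f.labels := by
  simp [edgeCount, fold_tree]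

/-- Each vertex of `c` owns one edge of `[c]_a`, the one towards the root, so having no edges forces
`c` to be empty. Additivity of the edge count then lets the existential predicate `IsVertexProduct`
pass to factors. -/
theorem edgeCount_eq_zero {f : Forest α} : edgeCount f = 0 ↔ f.IsVertexProduct := by
  constructor
  · intro h
    induction f using Forest.induction_on with
    | one => exact ⟨0, by simp⟩
    | tree_mul a c r _ ih =>
      rw [edgeCount_mul, edgeCount_tree, Nat.add_eq_zero_iff] at h
      obtain ⟨m, rfl⟩ := ih h.2
      have hc : c = 1 := by
        by_contra hc
        exact labels_ne_zero hc (Multiset.card_eq_zero.mp h.1)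
      exact ⟨a ::ₘ m, by simp [hc, vertex]⟩
  · rintro ⟨m, rfl⟩
    induction m using Multiset.induction_on with
    | empty => exact edgeCount_one
    | cons a m ih =>
      rw [Multiset.map_cons, Multiset.prod_cons, edgeCount_mul, ih, vertex, edgeCount_tree,
        labels_one, Multiset.card_zero]

theorem isVertexProduct_vertex_mul {a : α} {r : Forest α} :
    (vertex a * r).IsVertexProduct ↔ r.IsVertexProduct := by
  rw [← edgeCount_eq_zero, ← edgeCount_eq_zero, edgeCount_mul, vertex, edgeCount_tree, labels_one,
    Multiset.card_zero, zero_add]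

theorem not_isVertexProduct_tree_mul {a : α} {c r : Forest α} (hc : c ≠ 1) :
    ¬ (tree a c * r).IsVertexProduct := by
  rw [← edgeCount_eq_zero, edgeCount_mul, edgeCount_tree, Nat.add_eq_zero_iff,
    Multiset.card_eq_zero]
  exact fun h => labels_ne_zero hc h.1

theorem map_tree (j : α → β) (a : α) (f : Forest α) : (tree a f).map j = tree (j a) (f.map j) :=
  fold_tree _ a f

theorem weight_mul (w : α → ℕ) (f g : Forest α) :
    weight w (f * g) = weight w f + weight w g := by
  simp [weight, labels_mul]

theorem weight_tree (w : α → ℕ) (a : α) (f : Forest α) :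
    weight w (tree a f) = w a + weight w f := by
  simp [weight, labels_tree]

end Forest

/-! ### Counit and relabelling on the Connes-Kreimer algebra -/

namespace CK

variable {α β : Type}

theorem of_one : (of 1 : CK α) = 1 := rfl

theorem of_mul (f g : Forest α) : of (f * g) = of f * of g := by
  simp [of, MonoidAlgebra.single_mul_single]

theorem hom_ext {V : Type*} [AddCommGroup V] [Module ℝ V] {F G : CK α →ₗ[ℝ] V}
    (h : ∀ f, F (of f) = G (of f)) : F = G :=
  MonoidAlgebra.lhom_ext' fun f => LinearMap.ext_ring (h f)

theorem tensor_hom_ext {V : Type*} [AddCommGroup V] [Module ℝ V] {F G : CK α ⊗[ℝ] CK β →ₗ[ℝ] V}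
    (h : ∀ f g, F (of f ⊗ₜ of g) = G (of f ⊗ₜ of g)) : F = G :=
  TensorProduct.ext <| hom_ext fun f => hom_ext fun g => h f g

theorem tensor_induction {P : CK α ⊗[ℝ] CK β → Prop} (t : CK α ⊗[ℝ] CK β)
    (of : ∀ f g, P (of f ⊗ₜ of g)) (add : ∀ x y, P x → P y → P (x + y))
    (smul : ∀ (c : ℝ) x, P x → P (c • x)) : P t := by
  let S : Submodule ℝ (CK α ⊗[ℝ] CK β) :=
    { carrier := {x | P x}
      add_mem' := fun {x y} => add x y
      zero_mem' := by simpa using smul 0 _ (of 1 1)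
      smul_mem' := smul }
  have h : S.mkQ = 0 := tensor_hom_ext fun f g => (Submodule.Quotient.mk_eq_zero S).mpr (of f g)
  exact (Submodule.Quotient.mk_eq_zero S).mp (congrArg (fun F => F t) h)

theorem lift_of {R : Type*} [CommRing R] [Algebra ℝ R] (F : Forest α →* R) (f : Forest α) :
    MonoidAlgebra.lift ℝ R (Forest α) F (of f) = F f := by
  simp [of]

/-- The linear map `f ↦ [f]_a`. -/
def plant (a : α) : CK α →ₗ[ℝ] CK α := linExt fun f => of (Forest.tree a f)

theorem plant_of (a : α) (f : Forest α) : plant a (of f) = of (Forest.tree a f) :=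
  linExt_of _ f

theorem coproduct_tree (a : α) (f : Forest α) :
    coproduct (of (Forest.tree a f)) =
      of (Forest.tree a f) ⊗ₜ[ℝ] 1 +
        TensorProduct.map LinearMap.id (plant a) (coproduct (of f)) := by
  rw [coproduct, lift_of, lift_of, Forest.fold_tree]
  rfl

/-- The counit, which extracts the coefficient of the empty forest. -/
def counit : CK α →ₐ[ℝ] ℝ :=
  MonoidAlgebra.lift ℝ ℝ (Forest α) (Forest.fold fun _ _ _ => 0)

theorem counit_one : counit (of 1 : CK α) = 1 := map_one counit

theorem counit_tree (a : α) (f : Forest α) : counit (of (Forest.tree a f)) = 0 := by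
  rw [counit, lift_of, Forest.fold_tree]

theorem counit_of {f : Forest α} (hf : f ≠ 1) : counit (of f) = 0 := by
  induction f using Forest.induction_on with
  | one => exact absurd rfl hf
  | tree_mul a c r _ _ => rw [of_mul, map_mul, counit_tree, zero_mul]

/-- The map `x ⊗ y ↦ ε(y) x`. -/
def counitRight : CK α ⊗[ℝ] CK α →ₐ[ℝ] CK α :=
  Algebra.TensorProduct.lift (AlgHom.id ℝ (CK α))
    ((Algebra.ofId ℝ (CK α)).comp counit) fun _ _ => Commute.all _ _

theorem counitRight_tmul (x y : CK α) : counitRight (x ⊗ₜ y) = counit y • x := by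
  rw [counitRight, Algebra.TensorProduct.lift_tmul, Algebra.smul_def, mul_comm]
  rfl

/-- The counit kills trees, so only `[c]_a ⊗ 1` survives from the coproduct of `[c]_a`. Recovering a
forest linearly from its coproduct later allows an identity about forests to be stated for arbitrary
tensors. -/
theorem counitRight_coproduct (f : Forest α) : counitRight (coproduct (of f)) = of f := by
  induction f using Forest.induction_on with
  | one => rw [of_one, map_one, map_one]
  | tree_mul a c r _ ihr =>
    have h : counitRight.toLinearMap ∘ₗ TensorProduct.map LinearMap.id (plant a) = 0 :=
      tensor_hom_ext fun f g => by simp [counitRight_tmul, plant_of, counit_tree]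
    have h' := congrArg (fun F => F (coproduct (of c))) h
    simp only [LinearMap.comp_apply, AlgHom.toLinearMap_apply, LinearMap.zero_apply] at h'
    rw [of_mul, map_mul, map_mul, ihr, coproduct_tree, map_add, h', counitRight_tmul, add_zero,
      map_one, one_smul]

/-- The algebra morphism induced by a partial map of labels: forests with a label that has no image
are sent to zero. -/
def relabel (j : β → Option α) : CK β →ₐ[ℝ] CK α :=
  MonoidAlgebra.lift ℝ (CK α) (Forest β) <|
    Forest.fold fun b _ m => (j b).elim 0 fun a => plant a m

theorem relabel_tree (j : β → Option α) (b : β) (f : Forest β) :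
    relabel j (of (Forest.tree b f)) = (j b).elim 0 fun a => plant a (relabel j (of f)) := by
  rw [relabel, lift_of, lift_of, Forest.fold_tree]

theorem relabel_of (j : β → Option α) (f : Forest β) :
    relabel j (of f) =
      WithZero.recZeroCoe (motive := fun _ => CK α) 0 of (f.partialMap j) := by
  induction f using Forest.induction_on with
  | one => rw [of_one, map_one, map_one]; rfl
  | tree_mul b c r ihc ihr =>
    rw [of_mul, map_mul, map_mul, ihr, relabel_tree, ihc, Forest.partialMap, Forest.fold_tree,
      ← Forest.partialMap]
    cases j b with
    | none => simp
    | some a =>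
      induction c.partialMap j using WithZero.recZeroCoe with
      | zero => simp
      | coe c' =>
        induction r.partialMap j using WithZero.recZeroCoe with
        | zero => simp
        | coe r' =>
          rw [Option.elim_some, WithZero.recZeroCoe_coe, WithZero.recZeroCoe_coe, plant_of, ← of_mul]
          rfl

theorem relabel_map {j : β → Option α} {i : α → β} (hij : ∀ a, j (i a) = some a) (f : Forest α) :
    relabel j (of (f.map i)) = of f := by
  induction f using Forest.induction_on with
  | one => rw [map_one, of_one, of_one, map_one]
  | tree_mul a c r ihc ihr =>
    rw [map_mul, Forest.map_tree, of_mul, map_mul, ihr, relabel_tree, hij, Option.elim_some, ihc,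
      plant_of, ← of_mul]

theorem coproduct_plant (a : α) (x : CK α) :
    coproduct (plant a x) =
      plant a x ⊗ₜ[ℝ] 1 + TensorProduct.map LinearMap.id (plant a) (coproduct x) := by
  have h : coproduct.toLinearMap ∘ₗ plant a =
      (TensorProduct.mk ℝ (CK α) (CK α)).flip 1 ∘ₗ plant a +
        TensorProduct.map LinearMap.id (plant a) ∘ₗ coproduct.toLinearMap :=
    hom_ext fun f => by simpa [plant_of] using coproduct_tree a f
  exact congrArg (fun F => F x) h

/-- Cuts do not see labels: planting on a root `b` in the right factor corresponds to planting on `j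
b`, and a label without image kills every term on both sides. Chen's relation passes to the
extension through this. -/
theorem coproduct_relabel (j : β → Option α) (f : Forest β) :
    coproduct (relabel j (of f)) =
      Algebra.TensorProduct.map (relabel j) (relabel j) (coproduct (of f)) := by
  induction f using Forest.induction_on with
  | one => simp only [of_one, map_one]
  | tree_mul b c r ihc ihr =>
    rw [of_mul, map_mul, map_mul, map_mul, map_mul, ihr, coproduct_tree, map_add,
      Algebra.TensorProduct.map_tmul, map_one]
    congr 1
    have h : (Algebra.TensorProduct.map (relabel j) (relabel j)).toLinearMap ∘ₗ
        TensorProduct.map LinearMap.id (plant b) =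
        ((j b).elim 0 fun a => TensorProduct.map LinearMap.id (plant a)) ∘ₗ
          (Algebra.TensorProduct.map (relabel j) (relabel j)).toLinearMap :=
      tensor_hom_ext fun f g => by
        simp only [LinearMap.comp_apply, AlgHom.toLinearMap_apply, TensorProduct.map_tmul,
          Algebra.TensorProduct.map_tmul, LinearMap.id_apply, plant_of, relabel_tree]
        cases j b <;> simp
    have h' := congrArg (fun F => F (coproduct (of c))) h
    simp only [LinearMap.comp_apply, AlgHom.toLinearMap_apply] at h'
    rw [h', ← ihc, relabel_tree]
    cases j b with
    | none => simp
    | some a => exact coproduct_plant a _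

end CK

end

noncomputable section

/-! ### Splitting off last letters under `φ` -/

namespace QuasiShuffle

variable {α : Type} (B : LetterBracket α)

theorem mul_eq_mulLin (x y : QuasiShuffle B) : x * y = mulLin B x y := rfl

theorem phi_tree (a : α) (f : Forest α) :
    phi B (CK.of (Forest.tree a f)) = appendLetter B a (phi B (CK.of f)) := by
  rw [phi, CK.lift_of, CK.lift_of, Forest.fold_tree]

theorem phi_plant (a : α) (x : CK α) : phi B (CK.plant a x) = appendLetter B a (phi B x) := by
  have h : (phi B).toLinearMap ∘ₗ CK.plant a = appendLetter B a ∘ₗ (phi B).toLinearMap :=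
    CK.hom_ext fun f => by simpa [CK.plant_of] using phi_tree B a f
  exact congrArg (fun F => F x) h

theorem iota_one : iota B 1 = CK.of 1 := linExt_word B _ _

theorem iota_appendLetter (a : α) (x : QuasiShuffle B) :
    iota B (appendLetter B a x) = CK.plant a (iota B x) := by
  have h : iota B ∘ₗ appendLetter B a = CK.plant a ∘ₗ iota B :=
    hom_ext B fun w => by
      rw [LinearMap.comp_apply, LinearMap.comp_apply, appendLetter_word, iota, linExt_word,
        linExt_word, CK.plant_of, ladder]
  exact congrArg (fun F => F x) h

/-- `k` assigns to a product of single vertices the iterated bracket of its labels, and it is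
`none` at all other forests. -/
structure IsForestBracket (k : Forest α → Option α) : Prop where
  one : k 1 = none
  vertex : ∀ a, k (Forest.vertex a) = some a
  vertex_mul : ∀ a r, r ≠ 1 → k (Forest.vertex a * r) = (k r).bind (B.br a)
  tree_mul : ∀ a c r, c ≠ 1 → k (Forest.tree a c * r) = none

/-- The map `f ⊗ g ↦ [f]_{k(g)}`, which is zero if `k(g)` does not exist. -/
def plantBracket (k : Forest α → Option α) : CK α ⊗[ℝ] CK α →ₗ[ℝ] CK α :=
  TensorProduct.lift <| CK.linExt fun f => CK.linExt fun g =>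
    (k g).elim 0 fun a => CK.of (Forest.tree a f)

theorem plantBracket_of (k : Forest α → Option α) (f g : Forest α) :
    plantBracket k (CK.of f ⊗ₜ CK.of g) = (k g).elim 0 fun a => CK.of (Forest.tree a f) := by
  rw [plantBracket, TensorProduct.lift.tmul, CK.linExt_of, CK.linExt_of]

theorem phi_plantBracket_of (k : Forest α → Option α) (f g : Forest α) :
    phi B (plantBracket k (CK.of f ⊗ₜ CK.of g)) = appendOption B (k g) (phi B (CK.of f)) := by
  rw [plantBracket_of]
  cases k g with
  | none => exact map_zero _
  | some a => exact phi_tree B a f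

variable {B}

/-- This is the quasi-shuffle recursion in coproduct form. For `t`, `s` the coproducts of `c`, `r`,
the first bracket is the coproduct of `[c]_a r`, and `CK.counitRight` returns `c` and `r`. Written
this way both sides are bilinear in `t` and `s`, so tensors of forests suffice. -/
theorem phi_plantBracket_mul {k : Forest α → Option α} (hk : IsForestBracket B k) (a : α)
    (t s : CK α ⊗[ℝ] CK α) :
    phi B (plantBracket k ((CK.plant a (CK.counitRight t) ⊗ₜ 1 +
        TensorProduct.map LinearMap.id (CK.plant a) t) * s)) +
        appendLetter B a (phi B (CK.counitRight t) * phi B (plantBracket k s)) =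
      appendLetter B a (phi B (CK.counitRight t)) * phi B (plantBracket k s) +
        appendLetter B a (phi B (CK.counitRight t) * phi B (CK.counitRight s)) := by
  induction t using CK.tensor_induction with
  | add x y hx hy =>
    have := congrArg₂ (· + ·) hx hy
    simp only [map_add, TensorProduct.add_tmul, add_mul] at this ⊢
    linear_combination (exp := 1) this
  | smul c x hx =>
    have := congrArg (c • ·) hx
    simpa only [map_smul, ← TensorProduct.smul_tmul', ← smul_add, smul_mul_assoc] using this
  | of c₁ c₂ =>
    induction s using CK.tensor_induction with
    | add x y hx hy =>
      have := congrArg₂ (· + ·) hx hy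
      simp only [map_add, mul_add] at this ⊢
      linear_combination (exp := 1) this
    | smul c x hx =>
      have := congrArg (c • ·) hx
      simpa only [map_smul, ← smul_add, mul_smul_comm] using this
    | of r₁ r₂ =>
      rw [CK.counitRight_tmul, CK.counitRight_tmul, TensorProduct.map_tmul, add_mul,
        Algebra.TensorProduct.tmul_mul_tmul, Algebra.TensorProduct.tmul_mul_tmul, one_mul,
        LinearMap.id_apply, CK.plant_of, ← CK.of_mul, ← CK.of_mul, map_add, map_add,
        phi_plantBracket_of, phi_plantBracket_of]
      by_cases hc : c₂ = 1
      -- The part of `c` below the cut is empty, so `a` is a bare root: the last letter is `k r₂`,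
      -- `a` or their bracket, matching the three terms of the recursion.
      · subst hc
        rw [CK.counit_one, one_smul, CK.plant_of, ← CK.of_mul, phi_plantBracket_of, CK.of_mul,
          CK.of_mul, map_mul (phi B), map_mul (phi B), phi_tree]
        simp only [mul_eq_mulLin]
        rw [mulLin_appendOption_right]
        -- If nothing of `r` lies below the cut, `a` alone is split off, which accounts for the last
        -- term on the right. Otherwise the counit kills that term.
        by_cases hr : r₂ = 1
        · subst hr
          rw [mul_one, hk.one, ← Forest.vertex, hk.vertex, CK.counit_one, one_smul]
          simp [appendOption]
        · rw [← Forest.vertex, hk.vertex_mul a _ hr, CK.counit_of hr]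
          simp only [zero_smul, map_zero]
          abel
      -- Below the cut there is a tree with an edge, so no letter exists and every term vanishes.
      · rw [CK.counit_of hc, hk.tree_mul _ _ _ hc]
        simp [appendOption]

/-- `φ` is unchanged by splitting off the last letters. -/
theorem phi_plantBracket_coproduct {k : Forest α → Option α} (hk : IsForestBracket B k)
    (f : Forest α) :
    phi B (plantBracket k (CK.coproduct (CK.of f))) =
      phi B (CK.of f) - algebraMap ℝ _ (CK.counit (CK.of f)) := by
  induction f using Forest.induction_on with
  | one =>
    rw [CK.of_one, map_one CK.coproduct, map_one (phi B), map_one CK.counit, (algebraMap ℝ (QuasiShuffle B)).map_one, sub_self,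
      Algebra.TensorProduct.one_def, ← CK.of_one, phi_plantBracket_of, hk.one]
    rfl
  | tree_mul a c r _ ihr =>
    have h := phi_plantBracket_mul hk a (CK.coproduct (CK.of c)) (CK.coproduct (CK.of r))
    rw [CK.counitRight_coproduct, CK.counitRight_coproduct, CK.plant_of, ← CK.coproduct_tree,
      ← map_mul, ← CK.of_mul, ihr] at h
    rw [CK.counit_of (Forest.tree_mul_ne_one a c r), map_zero, sub_zero, CK.of_mul, map_mul (phi B),
      phi_tree, ← CK.of_mul, eq_sub_of_add_eq h]
    -- The inductive hypothesis contributes `ε(r)` twice, each time multiplying `φ(c) a`; the two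
    -- corrections cancel.
    rw [mul_sub, mul_sub, map_sub, mul_comm _ (algebraMap ℝ _ _), mul_comm _ (algebraMap ℝ _ _),
      ← Algebra.smul_def, ← Algebra.smul_def, map_smul]
    abel

end QuasiShuffle

end

/-! ### Rough paths pulled back along a relabelling -/

noncomputable section

variable {α β : Type}

theorem pairing_of (f : Forest α) (X : Forest α → ℝ) : pairing (CK.of f) X = X f :=
  CK.linExt_of X f

theorem extendThrough_eq (j : β → Option α) (X : ℝ → ℝ → Forest α → ℝ) (s t : ℝ) (f : Forest β) :
    extendThrough j X s t f = CK.linExt (X s t) (CK.relabel j (CK.of f)) := by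
  rw [CK.relabel_of, extendThrough]
  induction f.partialMap j using WithZero.recZeroCoe with
  | zero => simp
  | coe g => rw [WithZero.recZeroCoe_coe, WithZero.recZeroCoe_coe, CK.linExt_of]

theorem linExt_extendThrough (j : β → Option α) (X : ℝ → ℝ → Forest α → ℝ) (s t : ℝ) :
    CK.linExt (extendThrough j X s t) = CK.linExt (X s t) ∘ₗ (CK.relabel j).toLinearMap :=
  CK.hom_ext fun f => by rw [CK.linExt_of, extendThrough_eq]; rfl

theorem pairing_extendThrough (j : β → Option α) (X : ℝ → ℝ → Forest α → ℝ) (s t : ℝ) (x : CK β) :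
    pairing x (extendThrough j X s t) = pairing (CK.relabel j x) (X s t) := by
  rw [pairing, linExt_extendThrough]; rfl

/-- A partial relabelling that preserves weights sends a forest to zero or to a forest of the same
weight. -/
theorem CK.relabel_of_eq {w : α → ℕ} {v : β → ℕ} {j : β → Option α}
    (hj : ∀ b a, j b = some a → w a = v b) (f : Forest β) :
    CK.relabel j (CK.of f) = 0 ∨
      ∃ g : Forest α, CK.relabel j (CK.of f) = CK.of g ∧ g.weight w = f.weight v := by
  induction f using Forest.induction_on with
  | one => exact Or.inr ⟨1, by rw [CK.of_one, map_one, CK.of_one], rfl⟩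
  | tree_mul b c r ihc ihr =>
    rw [CK.of_mul, map_mul, CK.relabel_tree]
    cases hb : j b with
    | none => simp
    | some a =>
      rcases ihc with hc | ⟨c', hc, hcw⟩
      · simp [hc]
      rcases ihr with hr | ⟨r', hr, hrw⟩
      · simp [hr]
      refine Or.inr ⟨Forest.tree a c' * r', ?_, ?_⟩
      · rw [hc, hr, Option.elim_some, CK.plant_of, CK.of_mul]
      · rw [Forest.weight_mul, Forest.weight_mul, Forest.weight_tree, Forest.weight_tree, hcw, hrw,
          hj b a hb]

/-- The extension is `X` composed with a weight-preserving morphism of algebras and coalgebras. Each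
axiom is thus trivial at a forest sent to zero and inherited from `X` at any other. -/
theorem IsBranchedRoughPath.extendThrough {w : α → ℕ} {v : β → ℕ} {T p : ℝ} {ω : ℝ → ℝ → ℝ}
    {X : ℝ → ℝ → Forest α → ℝ} (hX : IsBranchedRoughPath w T p ω X) {j : β → Option α}
    (hj : ∀ b a, j b = some a → w a = v b) :
    IsBranchedRoughPath v T p ω (extendThrough j X) where
  truncated s t hs hst ht f hf := by
    rw [extendThrough_eq]
    rcases CK.relabel_of_eq hj f with h | ⟨g, h, hg⟩
    · rw [h, map_zero]
    · rw [h, CK.linExt_of, hX.truncated s t hs hst ht g (hg ▸ hf)]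
  continuousOn f := by
    simp only [extendThrough_eq]
    rcases CK.relabel_of_eq hj f with h | ⟨g, h, -⟩
    · simpa only [h, map_zero] using continuousOn_const
    · simpa only [h, CK.linExt_of] using hX.continuousOn g
  unit s t hs hst ht := by
    rw [extendThrough_eq, CK.of_one, map_one, ← CK.of_one, CK.linExt_of, hX.unit s t hs hst ht]
  regularity f hf := by
    simp only [extendThrough_eq]
    rcases CK.relabel_of_eq hj f with h | ⟨g, h, hg⟩
    · exact ⟨0, fun s t _ _ _ => by simp [h]⟩
    · simpa only [h, CK.linExt_of, hg] using hX.regularity g (hg ▸ hf)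
  multiplicativity s u t hs hsu hut ht f hf := by
    have hc : TensorProduct.map (CK.linExt (_root_.extendThrough j X s u))
        (CK.linExt (_root_.extendThrough j X u t)) (CK.coproduct (CK.of f)) =
        TensorProduct.map (CK.linExt (X s u)) (CK.linExt (X u t))
          (CK.coproduct (CK.relabel j (CK.of f))) := by
      rw [CK.coproduct_relabel, linExt_extendThrough, linExt_extendThrough, TensorProduct.map_comp]
      rfl
    rw [hc, extendThrough_eq]
    rcases CK.relabel_of_eq hj f with h | ⟨g, h, hg⟩
    · simp only [h, map_zero]
    · rw [h, CK.linExt_of, hX.multiplicativity s u t hs hsu hut ht g (hg ▸ hf)]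
  products s t hs hst ht f f' hf := by
    rw [extendThrough_eq, extendThrough_eq, extendThrough_eq, CK.of_mul, map_mul]
    rcases CK.relabel_of_eq hj f with h | ⟨g, h, hg⟩
    · simp [h]
    rcases CK.relabel_of_eq hj f' with h' | ⟨g', h', hg'⟩
    · simp [h']
    rw [h, h', ← CK.of_mul, CK.linExt_of, CK.linExt_of, CK.linExt_of,
      hX.products s t hs hst ht g g' (by rwa [hg, hg'])]

/-! ### Grading by the number of vertices -/

/-- The span of the tensors of forests with `n` vertices in total. -/
def CK.homogeneous (n : ℕ) : Submodule ℝ (CK α ⊗[ℝ] CK α) :=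
  Submodule.span ℝ {t | ∃ f g : Forest α,
    Multiset.card f.labels + Multiset.card g.labels = n ∧ CK.of f ⊗ₜ CK.of g = t}

/-- A cut distributes the vertices between its two sides. Counting vertices instead of weights gives
a strict descent whenever the lower side is nonempty, whatever the weights. -/
theorem CK.coproduct_mem_homogeneous (f : Forest α) :
    CK.coproduct (CK.of f) ∈ CK.homogeneous (Multiset.card f.labels) := by
  induction f using Forest.induction_on with
  | one =>
    rw [CK.of_one, map_one]
    exact Submodule.subset_span ⟨1, 1, rfl, rfl⟩
  | tree_mul a c r ihc ihr =>
    have htree : CK.coproduct (CK.of (Forest.tree a c)) ∈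
        CK.homogeneous (Multiset.card (Forest.tree a c).labels) := by
      rw [CK.coproduct_tree]
      refine Submodule.add_mem _ (Submodule.subset_span ⟨_, 1, rfl, rfl⟩) ?_
      have h : (CK.homogeneous (Multiset.card c.labels)).map
          (TensorProduct.map LinearMap.id (CK.plant a)) ≤
          CK.homogeneous (Multiset.card (Forest.tree a c).labels) := by
        rw [CK.homogeneous, Submodule.map_span, Submodule.span_le]
        rintro _ ⟨_, ⟨f, g, hfg, rfl⟩, rfl⟩
        refine Submodule.subset_span ⟨f, Forest.tree a g, ?_, ?_⟩
        · rw [Forest.labels_tree, Forest.labels_tree, Multiset.card_add, Multiset.card_add, ← hfg]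
          exact Nat.add_left_comm _ _ _
        · rw [TensorProduct.map_tmul, CK.plant_of, LinearMap.id_apply]
      exact h (Submodule.mem_map_of_mem ihc)
    rw [CK.of_mul, map_mul, Forest.labels_mul, Multiset.card_add]
    have h : CK.homogeneous (α := α) (Multiset.card (Forest.tree a c).labels) *
        CK.homogeneous (Multiset.card r.labels) ≤
        CK.homogeneous (Multiset.card (Forest.tree a c).labels + Multiset.card r.labels) := by
      rw [CK.homogeneous, CK.homogeneous, Submodule.span_mul_span, Submodule.span_le]
      rintro _ ⟨_, ⟨f, g, hfg, rfl⟩, _, ⟨f', g', hfg', rfl⟩, rfl⟩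
      refine Submodule.subset_span ⟨f * f', g * g', ?_, ?_⟩
      · rw [Forest.labels_mul, Forest.labels_mul, Multiset.card_add, Multiset.card_add]
        omega
      · rw [CK.of_mul, CK.of_mul]
        exact (Algebra.TensorProduct.tmul_mul_tmul _ _ _ _).symm
    exact h (Submodule.mul_mem_mul htree ihr)

/-! ### Linear grafting at a marked place -/

namespace MarkedForest

/-- The linear extension of grafting. -/
def graftLin (P : MarkedForest α) : CK α →ₗ[ℝ] CK α := CK.linExt fun h => CK.of (P.graft h)

theorem graftLin_of (P : MarkedForest α) (f : Forest α) :
    P.graftLin (CK.of f) = CK.of (P.graft f) := CK.linExt_of _ f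

theorem graftLin_beside (g : Forest α) (x : CK α) : (beside g).graftLin x = x * CK.of g := by
  have h : (beside g).graftLin = LinearMap.mulRight ℝ (CK.of g) :=
    CK.hom_ext fun f => by
      rw [graftLin_of, LinearMap.mulRight_apply, ← CK.of_mul, graft]
  exact congrArg (fun F => F x) h

theorem graftLin_under (a : α) (P : MarkedForest α) (g : Forest α) (x : CK α) :
    (under a P g).graftLin x = CK.plant a (P.graftLin x) * CK.of g := by
  have h : (under a P g).graftLin =
      LinearMap.mulRight ℝ (CK.of g) ∘ₗ CK.plant a ∘ₗ P.graftLin :=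
    CK.hom_ext fun f => by
      simp only [LinearMap.comp_apply, graftLin_of, LinearMap.mulRight_apply, CK.plant_of]
      rw [← CK.of_mul, graft]
  exact congrArg (fun F => F x) h

theorem relabel_graftLin {j : β → Option α} {i : α → β} (hij : ∀ a, j (i a) = some a)
    (P : MarkedForest α) (x : CK β) :
    CK.relabel j ((P.map i).graftLin x) = P.graftLin (CK.relabel j x) := by
  induction P with
  | beside g =>
    rw [map, graftLin_beside, graftLin_beside, map_mul, CK.relabel_map hij]
  | under a P g ih =>
    have h (y : CK β) : CK.relabel j (CK.plant (i a) y) = CK.plant a (CK.relabel j y) := by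
      have h : (CK.relabel j).toLinearMap ∘ₗ CK.plant (i a) =
          CK.plant a ∘ₗ (CK.relabel j).toLinearMap :=
        CK.hom_ext fun f => by
          simp only [LinearMap.comp_apply, AlgHom.toLinearMap_apply, CK.plant_of, CK.relabel_tree,
            hij, Option.elim_some]
      exact congrArg (fun F => F y) h
    rw [map, graftLin_under, graftLin_under, map_mul, CK.relabel_map hij, h, ih]

/-- Insertion of a new vertex at the marked place, which becomes the marked place. -/
def insertVertex (a : α) : MarkedForest α → MarkedForest α
  | beside g => under a (beside 1) g
  | under b P g => under b (insertVertex a P) g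

/-- The root of a grafted tree can be absorbed into the marked forest, leaving a smaller forest to
graft; this is the induction move of the converse. -/
theorem graftLin_insertVertex (a : α) (P : MarkedForest α) (x : CK α) :
    (P.insertVertex a).graftLin x = P.graftLin (CK.plant a x) := by
  induction P with
  | beside g =>
    rw [insertVertex, graftLin_under, graftLin_beside, graftLin_beside, CK.of_one, mul_one]
  | under b P g ih => rw [insertVertex, graftLin_under, graftLin_under, ih]

/-- The image under `φ` of a grafting depends on the grafted element only through its image. -/
theorem phi_graftLin_congr (B : LetterBracket α) (P : MarkedForest α) {x y : CK α}
    (h : QuasiShuffle.phi B x = QuasiShuffle.phi B y) :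
    QuasiShuffle.phi B (P.graftLin x) = QuasiShuffle.phi B (P.graftLin y) := by
  induction P with
  | beside g => rw [graftLin_beside, graftLin_beside, map_mul, map_mul, h]
  | under a P g ih =>
    rw [graftLin_under, graftLin_under, map_mul, map_mul, QuasiShuffle.phi_plant,
      QuasiShuffle.phi_plant, ih]

end MarkedForest

/-! ### Bracket letters and the root labelling map -/

theorem Hat.ofForest_vertex (a : α) : Hat.ofForest (Forest.vertex a) = some (Hat.letter a) := by
  have h : ∃ b : α, Forest.vertex a = Forest.vertex b := ⟨a, rfl⟩
  have hp : ¬ (Forest.vertex a).IsProper := fun hp => hp.2 ⟨a, 1, rfl⟩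
  rw [Hat.ofForest, dif_neg hp, dif_pos h, ← Forest.vertex_injective h.choose_spec]

theorem Hat.ofForest_of_isProper {f : Forest α} (hf : f.IsProper) :
    Hat.ofForest f = some (Hat.bracket f hf) := dif_pos hf

theorem Hat.ofForest_one : Hat.ofForest (1 : Forest α) = none := by
  have h : ¬ ∃ a : α, (1 : Forest α) = Forest.vertex a := fun ⟨a, ha⟩ => by
    have := congrArg Forest.rootCount ha
    rw [Forest.rootCount_one, Forest.vertex, Forest.rootCount_tree] at this
    omega
  rw [Hat.ofForest, dif_neg fun h => h.1 rfl, dif_neg h]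

theorem Hat.ofForest_tree {a : α} {c : Forest α} (hc : c ≠ 1) :
    Hat.ofForest (Forest.tree a c) = none := by
  have h : ¬ ∃ b : α, Forest.tree a c = Forest.vertex b := fun ⟨b, hb⟩ =>
    hc (Forest.tree_eq_vertex hb)
  rw [Hat.ofForest, dif_neg fun h => h.2 ⟨a, c, rfl⟩, dif_neg h]

theorem relabel_rootLabel {j : Hat α → Option α} (hj : ∀ a, j (Hat.letter a) = some a)
    (t : CK α ⊗[ℝ] CK α) :
    CK.relabel j (rootLabel t) =
      QuasiShuffle.plantBracket (fun g => (Hat.ofForest g).bind j) t := by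
  have h : (CK.relabel j).toLinearMap ∘ₗ rootLabel =
      QuasiShuffle.plantBracket fun g => (Hat.ofForest g).bind j :=
    CK.tensor_hom_ext fun f g => by
      rw [QuasiShuffle.plantBracket_of, LinearMap.comp_apply, AlgHom.toLinearMap_apply, rootLabel,
        TensorProduct.lift.tmul, CK.linExt_of, CK.linExt_of]
      cases Hat.ofForest g with
      | none => simp
      | some b =>
        rw [Option.bind_some]
        simp only [CK.relabel_tree, CK.relabel_map hj, CK.plant_of]
  exact congrArg (fun F => F t) h

theorem rootLabel_of (f g : Forest α) : rootLabel (CK.of f ⊗ₜ CK.of g) =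
    (Hat.ofForest g).elim 0 fun b => CK.of (Forest.tree b (f.map Hat.letter)) := by
  rw [rootLabel, TensorProduct.lift.tmul, CK.linExt_of, CK.linExt_of]
  cases Hat.ofForest g <;> rfl

/-- Of the two terms removed in the reduced coproduct, `f ⊗ 1` has no root label, and `1 ⊗ f` gives
the single vertex `(f)`. -/
theorem rootLabel_coproduct_of_isProper {f : Forest α} (hf : f.IsProper) :
    rootLabel (CK.coproduct (CK.of f)) =
      rootLabel (CK.reducedCoproduct (CK.of f)) + CK.of (Forest.vertex (Hat.bracket f hf)) := by
  rw [CK.reducedCoproduct, map_sub, map_sub, ← CK.of_one, rootLabel_of, rootLabel_of,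
    Hat.ofForest_one, Hat.ofForest_of_isProper hf, Option.elim_none, Option.elim_some, map_one,
    sub_zero, Forest.vertex, sub_add_cancel]

/-- The consistency relations alone make an extension of a rough path a consistent bracket
extension: grafting beside the empty forest gives the bracket relations. -/
theorem isConsistentBracketExtension_of_consistency {w : α → ℕ} {T p : ℝ} {ω : ℝ → ℝ → ℝ}
    {X : ℝ → ℝ → Forest α → ℝ} {Y : ℝ → ℝ → Forest (Hat α) → ℝ}
    (hY : IsBranchedRoughPath (Hat.weight w) T p ω Y)
    (hXY : ∀ s t, 0 ≤ s → s ≤ t → t ≤ T → ∀ f : Forest α, Y s t (f.map Hat.letter) = X s t f)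
    (h : ∀ s t, 0 ≤ s → s ≤ t → t ≤ T → ∀ f : Forest α, f ≠ 1 → ∀ P : MarkedForest α,
      Y s t ((P.map Hat.letter).graft (f.map Hat.letter)) =
        pairing ((P.map Hat.letter).graftLin (rootLabel (CK.coproduct (CK.of f)))) (Y s t)) :
    IsConsistentBracketExtension w T p ω X Y where
  roughPath := hY
  extends_base := hXY
  bracket s t hs hst ht f hf := by
    -- Grafting with `ν = -` beside the empty forest changes nothing.
    have := h s t hs hst ht f hf.1 (.beside 1)
    rw [MarkedForest.map, map_one, MarkedForest.graft, MarkedForest.graftLin_beside, CK.of_one,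
      mul_one, mul_one, rootLabel_coproduct_of_isProper hf, pairing, map_add, CK.linExt_of] at this
    rw [bracketPolynomial, pairing, map_sub, CK.linExt_of, this, add_sub_cancel_left]
  consistency := h

/-! ### The equivalence for a general bracket -/

section Equivalence

open QuasiShuffle

variable {B : LetterBracket α}

theorem pairing_eq_of_isDeterminedByLadders {T : ℝ} {X : ℝ → ℝ → Forest α → ℝ}
    (hX : IsDeterminedByLadders B T X) {s t : ℝ} (hs : 0 ≤ s) (hst : s ≤ t) (ht : t ≤ T)
    {x y : CK α} (h : phi B x = phi B y) : pairing x (X s t) = pairing y (X s t) := by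
  have hlin : CK.linExt (X s t) =
      CK.linExt (X s t) ∘ₗ iota B ∘ₗ (phi B).toLinearMap :=
    CK.hom_ext fun f => by
      rw [CK.linExt_of]
      exact hX s t hs hst ht f
  rw [pairing, pairing, hlin]
  simp only [LinearMap.comp_apply, AlgHom.toLinearMap_apply, h]

/-- If the functional `x` is invariant under splitting off the last letters at every marked place,
it is determined by its values on ladders. -/
theorem pairing_graftLin_eq_iota_phi {k : Forest α → Option α} (hk : IsForestBracket B k)
    {x : Forest α → ℝ}
    (hx : ∀ f : Forest α, f ≠ 1 → ∀ P : MarkedForest α,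
      x (P.graft f) = pairing (P.graftLin (plantBracket k (CK.coproduct (CK.of f)))) x)
    (f : Forest α) (P : MarkedForest α) :
    x (P.graft f) = pairing (P.graftLin (iota B (phi B (CK.of f)))) x := by
  induction hn : Multiset.card f.labels using Nat.strong_induction_on generalizing f P with
  | h n ih =>
    by_cases hf : f = 1
    · rw [hf, CK.of_one, map_one, iota_one, MarkedForest.graftLin_of, pairing_of]
    -- The coproduct is a sum of tensors, so the claim is proved for two linear maps on the whole
    -- homogeneous component: on single-rooted terms `[f₁]_{k(f₂)}`, applying `ι ∘ φ` inside the
    -- grafting does not change the value of `x`.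
    have key : Set.EqOn (CK.linExt x ∘ₗ P.graftLin ∘ₗ plantBracket k)
        (CK.linExt x ∘ₗ P.graftLin ∘ₗ iota B ∘ₗ (phi B).toLinearMap ∘ₗ plantBracket k)
        (CK.homogeneous n : Submodule ℝ (CK α ⊗[ℝ] CK α)) := by
      refine LinearMap.eqOn_span ?_
      rintro _ ⟨f₁, f₂, hcard, rfl⟩
      simp only [LinearMap.comp_apply, plantBracket_of]
      cases hk₂ : k f₂ with
      | none => simp
      | some a =>
        have hf₂ : f₂ ≠ 1 := fun h => by rw [h, hk.one] at hk₂; exact Option.some_ne_none a hk₂.symm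
        have hpos : 0 < Multiset.card f₂.labels := Multiset.card_pos.mpr (Forest.labels_ne_zero hf₂)
        -- The lower part `f₂` is nonempty, so `f₁` has fewer vertices. The marked place changes
        -- here, hence the induction over all `P`.
        have h := ih _ (by omega) f₁ (P.insertVertex a) rfl
        rw [← pairing_of (MarkedForest.graft _ _) x, ← MarkedForest.graftLin_of,
          MarkedForest.graftLin_insertVertex, MarkedForest.graftLin_insertVertex,
          ← iota_appendLetter, ← phi_tree, CK.plant_of] at h
        exact h
    have h := key (hn ▸ CK.coproduct_mem_homogeneous f)
    simp only [LinearMap.comp_apply, AlgHom.toLinearMap_apply] at h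
    rw [phi_plantBracket_coproduct hk, CK.counit_of hf, map_zero, sub_zero] at h
    exact (hx f hf P).trans h

/-- Relabelling fixes old letters and commutes with grafting, so consistency of the extension is a
statement about `X` alone: invariance under splitting off last letters at every marked place. -/
theorem isDeterminedByLadders_iff {w : α → ℕ} {T p : ℝ} {ω : ℝ → ℝ → ℝ}
    {X : ℝ → ℝ → Forest α → ℝ} (hX : IsBranchedRoughPath w T p ω X) {j : Hat α → Option α}
    (hj : ∀ a, j (Hat.letter a) = some a)
    (hw : ∀ b a, j b = some a → w a = Hat.weight w b)
    (hk : IsForestBracket B fun g => (Hat.ofForest g).bind j) :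
    IsDeterminedByLadders B T X ↔ IsConsistentBracketExtension w T p ω X (extendThrough j X) := by
  have hbase (s t : ℝ) (P : MarkedForest α) (f : Forest α) :
      extendThrough j X s t ((P.map Hat.letter).graft (f.map Hat.letter)) = X s t (P.graft f) := by
    rw [extendThrough_eq, ← MarkedForest.graftLin_of, MarkedForest.relabel_graftLin hj,
      CK.relabel_map hj, MarkedForest.graftLin_of, CK.linExt_of]
  have hroot (s t : ℝ) (P : MarkedForest α) (f : Forest α) :
      pairing ((P.map Hat.letter).graftLin (rootLabel (CK.coproduct (CK.of f))))
        (extendThrough j X s t) =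
      pairing (P.graftLin (plantBracket (fun g => (Hat.ofForest g).bind j)
        (CK.coproduct (CK.of f)))) (X s t) := by
    rw [pairing_extendThrough, MarkedForest.relabel_graftLin hj, relabel_rootLabel hj]
  constructor
  · intro h
    refine isConsistentBracketExtension_of_consistency (hX.extendThrough hw) ?_ ?_
    · intro s t _ _ _ f
      rw [extendThrough_eq, CK.relabel_map hj, CK.linExt_of]
    · intro s t hs hst ht f hf P
      rw [hbase, hroot, ← pairing_of (P.graft f) (X s t), ← MarkedForest.graftLin_of]
      refine pairing_eq_of_isDeterminedByLadders h hs hst ht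
        (P.phi_graftLin_congr B ?_)
      rw [phi_plantBracket_coproduct hk, CK.counit_of hf, map_zero, sub_zero]
  · intro h s t hs hst ht f
    have hf := pairing_graftLin_eq_iota_phi hk (x := X s t)
      (fun f hf P => by
        rw [← hbase, ← hroot]
        exact h.consistency s t hs hst ht f hf P) f (.beside 1)
    rwa [MarkedForest.graft, mul_one, MarkedForest.graftLin_beside, CK.of_one, mul_one] at hf

end Equivalence

end

/-! ### The union bracket and the zero bracket -/

/-- The multiset underlying a letter. -/
def Tilde.val {κ : Type} (m : Tilde κ) : Multiset κ := m.1

theorem Tilde.ext {κ : Type} {a b : Tilde κ} (h : a.val = b.val) : a = b := Subtype.ext h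

theorem Tilde.val_joinLabels {κ : Type} (f : Forest (Tilde κ)) (hf : f ≠ 1) :
    (Tilde.joinLabels f hf).val = (f.labels.map Tilde.val).sum := rfl

theorem Tilde.weight_joinLabels {κ : Type} (f : Forest (Tilde κ)) (hf : f ≠ 1) :
    Tilde.weight (Tilde.joinLabels f hf) = f.weight Tilde.weight := by
  change Multiset.card (f.labels.map Tilde.val).sum = (f.labels.map Tilde.weight).sum
  induction f.labels using Multiset.induction_on with
  | empty => rfl
  | cons a m ih =>
    rw [Multiset.map_cons, Multiset.sum_cons, Multiset.card_add, ih, Multiset.map_cons,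
      Multiset.sum_cons]
    rfl

theorem Tilde.weight_of_join_eq_some {κ : Type} (b : Hat (Tilde κ)) (a : Tilde κ)
    (h : Tilde.join b = some a) : Tilde.weight a = Hat.weight Tilde.weight b := by
  rcases b with b | f
  · cases h
    rfl
  · rw [Tilde.join] at h
    split_ifs at h
    cases h
    exact Tilde.weight_joinLabels f.1 f.2.1

open Classical in
-- A single vertex is also a vertex product, with its own label as join. Old and new letters thus
-- obey one formula, and the bracket recursion reduces to additivity of label sums.
theorem Tilde.ofForest_bind_join {κ : Type} (f : Forest (Tilde κ)) :
    (Hat.ofForest f).bind Tilde.join =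
      if h : f ≠ 1 ∧ f.IsVertexProduct then some (Tilde.joinLabels f h.1) else none := by
  by_cases hf : f.IsProper
  · rw [Hat.ofForest_of_isProper hf, Option.bind_some]
    by_cases h : f.IsVertexProduct
    · rw [dif_pos ⟨hf.1, h⟩]
      exact if_pos h
    · rw [dif_neg fun h' => h h'.2]
      exact if_neg h
  by_cases h1 : f = 1
  · rw [h1, Hat.ofForest_one, dif_neg fun h => h.1 rfl]
    rfl
  obtain ⟨a, c, rfl⟩ : f.IsTree := by
    by_contra h
    exact hf ⟨h1, h⟩
  by_cases hc : c = 1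
  · subst hc
    have hv : (Forest.tree a (1 : Forest (Tilde κ))).IsVertexProduct :=
      ⟨{a}, by rw [Multiset.map_singleton, Multiset.prod_singleton, Forest.vertex]⟩
    rw [← Forest.vertex, Hat.ofForest_vertex, dif_pos ⟨h1, hv⟩]
    refine congrArg some (Tilde.ext ?_)
    rw [Tilde.val_joinLabels, Forest.labels_vertex, Multiset.map_singleton, Multiset.sum_singleton]
  · have hv := Forest.not_isVertexProduct_tree_mul (a := a) (r := 1) hc
    rw [mul_one] at hv
    rw [Hat.ofForest_tree hc, dif_neg fun h => hv h.2]
    rfl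

theorem Tilde.isForestBracket_join (κ : Type) :
    QuasiShuffle.IsForestBracket (Tilde.unionBracket κ)
      fun g => (Hat.ofForest g).bind Tilde.join where
  one := by rw [Hat.ofForest_one]; rfl
  vertex a := by rw [Hat.ofForest_vertex]; rfl
  vertex_mul a r hr := by
    simp only [Tilde.ofForest_bind_join]
    by_cases hv : r.IsVertexProduct
    · rw [dif_pos ⟨Forest.tree_mul_ne_one a 1 r, Forest.isVertexProduct_vertex_mul.mpr hv⟩,
        dif_pos ⟨hr, hv⟩, Option.bind_some]
      refine congrArg some (Tilde.ext ?_)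
      rw [Tilde.val_joinLabels, Forest.labels_mul, Forest.labels_vertex, Multiset.map_add,
        Multiset.sum_add, Multiset.map_singleton, Multiset.sum_singleton]
      rfl
    · rw [dif_neg fun h => hv (Forest.isVertexProduct_vertex_mul.mp h.2), dif_neg fun h => hv h.2,
        Option.bind_none]
  tree_mul a c r hc := by
    rw [Tilde.ofForest_bind_join, dif_neg fun h => Forest.not_isVertexProduct_tree_mul hc h.2]

/-- Only single vertices yield an old letter. A product of at least two trees yields a new letter,
which has no image, just as the zero bracket has no value. -/
theorem isForestBracket_getLeft (α : Type) :
    QuasiShuffle.IsForestBracket (zeroBracket α)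
      fun g => (Hat.ofForest g).bind fun b : Hat α => Sum.getLeft? b where
  one := by rw [Hat.ofForest_one]; rfl
  vertex a := by rw [Hat.ofForest_vertex]; rfl
  vertex_mul a r hr := by
    rw [Forest.vertex, Hat.ofForest_of_isProper (Forest.isProper_tree_mul_iff.mpr hr)]
    exact (Option.bind_fun_none _).symm
  tree_mul a c r hc := by
    by_cases hr : r = 1
    · rw [hr, mul_one, Hat.ofForest_tree hc]
      rfl
    · rw [Hat.ofForest_of_isProper (Forest.isProper_tree_mul_iff.mpr hr)]
      rfl

theorem mainTheorem4 (d : ℕ) (T p : ℝ) (hT : 0 ≤ T) (hp : 1 ≤ p)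
    (ω : ℝ → ℝ → ℝ) (hω : IsControl T ω) :
    (∀ X : ℝ → ℝ → Forest (Tilde (Fin d)) → ℝ,
      IsBranchedRoughPath Tilde.weight T p ω X →
        (IsQuasiGeometric T X ↔
          IsConsistentBracketExtension Tilde.weight T p ω X (joinExtension X))) ∧
    (∀ X : ℝ → ℝ → Forest (Fin d) → ℝ,
      IsBranchedRoughPath (fun _ => 1) T p ω X →
        (IsGeometric T X ↔
          IsConsistentBracketExtension (fun _ => 1) T p ω X (trivialExtension X))) := by
  refine ⟨fun X hX => ?_, fun X hX => ?_⟩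
  · exact isDeterminedByLadders_iff hX (fun _ => rfl) Tilde.weight_of_join_eq_some
      (Tilde.isForestBracket_join _)
  · refine isDeterminedByLadders_iff hX (fun _ => rfl) ?_ (isForestBracket_getLeft _)
    rintro (b | f) a h
    · rfl
    · cases h
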